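/- Graphs are finite and connected multigraphs with at least one vertex; loops and multiple edges are allowed, vertex-free circles are not. A *signed ribbon diagram* $\Gamma$ of $G=(V,E)$ consists of a cyclic order of the half-edges at every vertex and a sign $\pm1$ for every edge. It presents a *ribbon graph of $G$*: the surface made of an oriented disk for every vertex and a band for every edge, attached in the given cyclic orders, flat for the sign $+1$ and half-twisted for the sign $-1$. Let $\overline\Gamma$ be the closed surface obtained by gluing a disk (a *face*) to every boundary component. Ribbon graphs of $G$ are *equivalent* if there is a homeomorphism of the closed surfaces that induces an isomorphism of the embedded graphs. $\Gamma$ is a *plane graph* if $\overline\Gamma$ is a sphere, and $G$ is *planar* if it has a plane graph. An *$n$-face coloring* assigns one of $n$ colors to every face so that the two faces along any edge have different colors (none exists if some edge has the same face on both sides). The *blowup* of $\Gamma$ replaces every vertex by a circle through its half-edges, in their cyclic order. For $\alpha\in\{0,1\}^E$ the state $\alpha$ is the set of circles obtained by replacing each edge $e$ of the blowup by its $\alpha_e$-smoothing: for a positive edge the $0$-smoothing is a pair of parallel strands and the $1$-smoothing a pair of crossing strands, and for a negative edge these are exchanged. Let $k_\alpha$ be its number of circles and $|\alpha|=\sum_e\alpha_e$.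 The *Penrose polynomial* of $\Gamma$ is $P(\Gamma,n)=\sum_\alpha(-1)^{|\alpha|}n^{k_\alpha}$. The *state graph* $\Gamma_\alpha$ is the ribbon graph obtained from $\Gamma$ by inserting a half-twist into the band of each edge $e$ with $\alpha_e=1$. **Theorem.** (a) Let $\Gamma$ be a signed ribbon diagram of a connected graph $G$. Then for all $n\in\mathbb N$ $$P(\Gamma,n)=\sum_{|\alpha|\text{ even}}\#\{n\text{-face colorings of }\overline\Gamma_\alpha\}-\sum_{|\alpha|\text{ odd}}\#\{n\text{-face colorings of }\overline\Gamma_\alpha\}.$$ If moreover $\Gamma$ is a plane graph, then $P(\Gamma,n)=\sum_\alpha\#\{n\text{-face colorings of }\overline\Gamma_\alpha\}$. (b) Let $G$ be a connected trivalent graph. Call $\Gamma$ *nonnegative* if $P(\Gamma,n)$ is zero or has positive leading coefficient. Then $G$ has a nonnegative signed ribbon diagram, and all of them have the same Penrose polynomial; this is the Penrose polynomial $P(G,n)$ of $G$. (c) Let $G$ be a connected trivalent graph such that only the identity permutations of $V$ and $E$ together preserve incidence (trivial automorphism group), and let $\Gamma$ be a nonnegative ribbon graph of $G$. Call a ribbon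 graph of $G$ *even* with respect to $\Gamma$ if it is equivalent to $\Gamma$ after inserting an even number of half-twists into edges, and *odd* otherwise. Then for all $n\in\mathbb N$, with ribbon graphs of $G$ taken up to equivalence, $$P(G,n)=\#\{n\text{-face colorings of all even ribbon graphs of }G\}-\#\{n\text{-face colorings of all odd ribbon graphs of }G\}.$$ If moreover $G$ is planar, then $P(G,n)$ is the total number of $n$-face colorings on all ribbon graphs of $G$. -/

import Mathlib

open scoped Graph

noncomputable section

namespace Ribbon

universe u v

variable {α : Type u} {β : Type v}

/-! ### Multigraphs (loops and multiple edges allowed) -/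

/-- `G` is connected: it has a vertex, and any two vertices are joined by a walk. -/
def Connected (G : Graph α β) : Prop :=
  V(G).Nonempty ∧ ∀ x ∈ V(G), ∀ y ∈ V(G), Relation.ReflTransGen G.Adj x y

/-- Every vertex has degree three; a loop counts twice at its vertex. -/
def Trivalent (G : Graph α β) : Prop :=
  ∀ x ∈ V(G), (G.incidenceSet x).encard + (G.loopSet x).encard = 3

/-- An automorphism of a multigraph is a permutation of the vertices together with a permutation
of the edges that preserve incidence. The group of these is trivial. -/
def TrivialAut (G : Graph α β) : Prop :=
  ∀ (f : V(G) ≃ V(G)) (g : E(G) ≃ E(G)),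
    (∀ (e : E(G)) (x y : V(G)), G.IsLink e x y ↔ G.IsLink (g e) (f x) (f y)) →
      f = Equiv.refl _ ∧ g = Equiv.refl _

/-- The half-edges of `G`: each edge (also a loop) has two of them. -/
abbrev HalfEdge (G : Graph α β) : Type v := E(G) × Bool

theorem exists_ends (G : Graph α β) (e : E(G)) :
    ∃ p : V(G) × V(G), G.IsLink e p.1 p.2 := by
  obtain ⟨x, y, h⟩ := G.exists_isLink_of_mem_edgeSet e.2
  exact ⟨(⟨x, h.left_mem⟩, ⟨y, h.right_mem⟩), h⟩

/-- The vertex at which a half-edge is attached. The two half-edges of an edge are numbered by an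
arbitrary choice. -/
def vert (G : Graph α β) (h : HalfEdge G) : V(G) :=
  if h.2 then (exists_ends G h.1).choose.2 else (exists_ends G h.1).choose.1

theorem isLink_vert (G : Graph α β) (e : E(G)) :
    G.IsLink e (vert G (e, false)) (vert G (e, true)) := by
  simpa [vert] using (exists_ends G e).choose_spec

/-- The other half of the edge. -/
def opp {G : Graph α β} (h : HalfEdge G) : HalfEdge G := (h.1, !h.2)

/-! ### Ribbon graphs -/

/-- A signed ribbon diagram (signed rotation system) of `G`: a cyclic order of the half-edges at
every vertex, given by the permutation `next`, whose cycles are exactly the sets of half-edges at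
the vertices, and a sign for every edge. It presents the ribbon surface made of an oriented disk
for every vertex and a band for every edge; the bands are attached to the disks in the cyclic
order, flat for the sign `1` and with a half-twist for the sign `-1`. -/
structure Diagram (G : Graph α β) where
  next : Equiv.Perm (HalfEdge G)
  sameCycle_iff : ∀ h h' : HalfEdge G, next.SameCycle h h' ↔ vert G h = vert G h'
  sign : E(G) → ℤˣ

/-- The place where a side of a band meets its disk: `(h, 1)` is the side of the half-edge `h`
towards `next h` in the cyclic order, and `(h, -1)` is the other side. -/
abbrev Corner (G : Graph α β) : Type v := HalfEdge G × ℤˣ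

namespace Diagram

variable {G : Graph α β}

/-- The pieces of the boundary of the ribbon surface, as pairs of corners: the arcs of the boundary
of a disk between consecutive bands, and the two sides of every band. The sides of a flat band
between oriented disks join opposite sides of its two half-edges, and those of a half-twisted band
join equal ones. -/
inductive BoundaryArc (Γ : Diagram G) : Corner G → Corner G → Prop
  | disk (h : HalfEdge G) : BoundaryArc Γ (h, 1) (Γ.next h, -1)
  | band (h : HalfEdge G) (ε : ℤˣ) : BoundaryArc Γ (h, ε) (opp h, -(Γ.sign h.1 * ε))

/-- The faces of the ribbon graph, that is, the disks glued to the boundary components of the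
ribbon surface to close it. The disk of a vertex without edges is a component of the surface with
one boundary component, which meets no band. -/
def Face (Γ : Diagram G) : Type (max u v) :=
  Quot Γ.BoundaryArc ⊕ {x : V(G) // ∀ h, vert G h ≠ x}

/-- The face along the given side of the half-edge `h`. -/
def faceAt (Γ : Diagram G) (c : Corner G) : Γ.Face := Sum.inl (Quot.mk _ c)

/-- The `n`-face colorings: the two faces along an edge have different colors (so there is
none if the same face lies on both sides of an edge). -/
def FaceColoring (Γ : Diagram G) (n : ℕ) : Type (max u v) :=
  {c : Γ.Face → Fin n // ∀ h : HalfEdge G, c (Γ.faceAt (h, 1)) ≠ c (Γ.faceAt (h, -1))}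

/-- The number of `n`-face colorings. -/
def numFaceColorings (Γ : Diagram G) (n : ℕ) : ℕ := Nat.card (Γ.FaceColoring n)

open scoped Classical in
/-- Insert one half-twist into the band of each edge in `S`. For the state of the blowup in which
exactly the edges of `S` have a `1`-smoothing, this is the state graph. -/
def twist (Γ : Diagram G) (S : Finset E(G)) : Diagram G where
  next := Γ.next
  sameCycle_iff := Γ.sameCycle_iff
  sign e := if e ∈ S then -Γ.sign e else Γ.sign e

/-- `Γ` is a plane graph: the closed surface of `Γ`, for a connected graph, is a sphere, that is,
its Euler characteristic is two. -/
def IsPlane (Γ : Diagram G) : Prop :=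
  (Nat.card V(G) : ℤ) - Nat.card E(G) + Nat.card Γ.Face = 2

/-! ### Equivalence of ribbon graphs -/

/-- Equivalence of ribbon graphs of `G`. A homeomorphism of the closed surfaces that
induces an isomorphism of the embedded graphs permutes the vertices (`f`) and the half-edges
(`φ`, compatibly with the edges and vertices). It maps the disk of each vertex `x` to a disk and
preserves or reverses the chosen orientations (`o x = 1` or `o x = -1`), and so it preserves or
reverses the cyclic order there; a band is half-twisted in the image if and only if its sign and
the behavior at its two ends say so. -/
def Equivalent (Γ Δ : Diagram G) : Prop :=
  ∃ (f : Equiv.Perm V(G)) (φ : Equiv.Perm (HalfEdge G)) (o : V(G) → ℤˣ),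
    (∀ h, φ (opp h) = opp (φ h)) ∧
    (∀ h, vert G (φ h) = f (vert G h)) ∧
    (∀ h, o (vert G h) = 1 → φ (Γ.next h) = Δ.next (φ h)) ∧
    (∀ h, o (vert G h) = -1 → φ (Γ.next h) = Δ.next.symm (φ h)) ∧
    (∀ h, Δ.sign (φ h).1 = o (vert G h) * Γ.sign h.1 * o (vert G (opp h)))

theorem vert_next (Γ : Diagram G) (h : HalfEdge G) : vert G (Γ.next h) = vert G h :=
  ((Γ.sameCycle_iff _ _).1 ⟨1, by simp⟩).symm

theorem vert_next_symm (Γ : Diagram G) (h : HalfEdge G) :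
    vert G (Γ.next.symm h) = vert G h := by
  have := Γ.vert_next (Γ.next.symm h)
  simpa using this.symm

theorem Equivalent.refl (Γ : Diagram G) : Γ.Equivalent Γ :=
  ⟨Equiv.refl _, Equiv.refl _, fun _ => 1, by simp, by simp, by simp, by simp, by simp⟩

theorem Equivalent.symm {Γ Δ : Diagram G} (H : Γ.Equivalent Δ) : Δ.Equivalent Γ := by
  obtain ⟨f, φ, o, h1, h2, h3, h4, h5⟩ := H
  have key : ∀ h, f.symm (vert G h) = vert G (φ.symm h) := fun h => by
    rw [Equiv.symm_apply_eq, ← h2, Equiv.apply_symm_apply]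
  refine ⟨f.symm, φ.symm, fun x => o (f.symm x), ?_, ?_, ?_, ?_, ?_⟩
  · intro h
    rw [Equiv.symm_apply_eq, h1, Equiv.apply_symm_apply]
  · intro h
    exact (key h).symm
  · intro h ho
    beta_reduce at ho
    rw [key] at ho
    rw [Equiv.symm_apply_eq, h3 _ ho, Equiv.apply_symm_apply]
  · intro h ho
    beta_reduce at ho
    rw [key] at ho
    rw [Equiv.symm_apply_eq]
    have := h4 (Γ.next.symm (φ.symm h)) (by rw [vert_next_symm]; exact ho)
    rw [Equiv.apply_symm_apply, Equiv.apply_symm_apply, Equiv.eq_symm_apply] at this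
    exact this
  · intro h
    have h6 := h5 (φ.symm h)
    rw [Equiv.apply_symm_apply] at h6
    have h7 : φ.symm (opp h) = opp (φ.symm h) := by
      rw [Equiv.symm_apply_eq, h1, Equiv.apply_symm_apply]
    beta_reduce
    rw [key, key, h6, h7]
    rcases Int.units_eq_one_or (o (vert G (φ.symm h))) with a | a <;>
      rcases Int.units_eq_one_or (o (vert G (opp (φ.symm h)))) with b | b <;> simp [a, b]

theorem Equivalent.trans {Γ Δ Θ : Diagram G} (H : Γ.Equivalent Δ) (K : Δ.Equivalent Θ) :
    Γ.Equivalent Θ := by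
  obtain ⟨f, φ, o, h1, h2, h3, h4, h5⟩ := H
  obtain ⟨g, ψ, p, k1, k2, k3, k4, k5⟩ := K
  have inv : ∀ h, p (vert G h) = -1 → ψ (Δ.next.symm h) = Θ.next (ψ h) := fun h hp => by
    have := k4 (Δ.next.symm h) (by rwa [vert_next_symm])
    rw [Equiv.apply_symm_apply] at this
    rw [this, Equiv.apply_symm_apply]
  have inv' : ∀ h, p (vert G h) = 1 → ψ (Δ.next.symm h) = Θ.next.symm (ψ h) := fun h hp => by
    have := k3 (Δ.next.symm h) (by rwa [vert_next_symm])
    rw [Equiv.apply_symm_apply] at this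
    rw [this, Equiv.symm_apply_apply]
  refine ⟨f.trans g, φ.trans ψ, fun x => p (f x) * o x, ?_, ?_, ?_, ?_, ?_⟩
  · intro h
    simp [h1, k1]
  · intro h
    simp [h2, k2]
  · intro h ho
    beta_reduce at ho
    rw [← h2] at ho
    simp only [Equiv.trans_apply]
    rcases Int.units_eq_one_or (o (vert G h)) with a | a
    · rw [h3 h a, k3 _ (by simpa [a] using ho)]
    · rw [h4 h a, inv _ (by simpa [a, neg_eq_iff_eq_neg] using ho)]
  · intro h ho
    beta_reduce at ho
    rw [← h2] at ho
    simp only [Equiv.trans_apply]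
    rcases Int.units_eq_one_or (o (vert G h)) with a | a
    · rw [h3 h a, k4 _ (by simpa [a] using ho)]
    · rw [h4 h a, inv' _ (by simpa [a] using ho)]
  · intro h
    simp only [Equiv.trans_apply]
    rw [k5, h5, ← h1, h2, h2]
    ac_rfl

/-- The ribbon graphs of `G` up to equivalence. -/
def setoid (G : Graph α β) : Setoid (Diagram G) where
  r := Equivalent
  iseqv := ⟨Equivalent.refl, Equivalent.symm, Equivalent.trans⟩

theorem FaceColoring.card_le {Γ Δ : Diagram G} [Finite E(G)] [Finite V(G)] (n : ℕ)
    (H : Γ.Equivalent Δ) : Δ.numFaceColorings n ≤ Γ.numFaceColorings n := by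
  obtain ⟨f, φ, o, h1, h2, h3, h4, h5⟩ := H
  have hiso : ∀ x : V(G), (∀ h, vert G h ≠ x) → ∀ h, vert G h ≠ f x := fun x hx h he => by
    refine hx (φ.symm h) (f.injective ?_)
    rw [← he, ← h2, Equiv.apply_symm_apply]
  let m : Corner G → Corner G := fun c => (φ c.1, o (vert G c.1) * c.2)
  have hm : ∀ c d, Γ.BoundaryArc c d → Quot.mk Δ.BoundaryArc (m c) = Quot.mk _ (m d) := by
    intro c d hcd
    cases hcd with
    | disk h =>
      simp only [m, vert_next]
      rcases Int.units_eq_one_or (o (vert G h)) with a | a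
      · rw [h3 h a, a]
        exact Quot.sound (by simpa using BoundaryArc.disk (φ h))
      · rw [h4 h a, a]
        exact (Quot.sound (by simpa using BoundaryArc.disk (Γ := Δ) (Δ.next.symm (φ h)))).symm
    | band h ε =>
      refine Quot.sound ?_
      have := BoundaryArc.band (Γ := Δ) (φ h) (o (vert G h) * ε)
      simp only [m]
      rw [h1]
      convert this using 2
      rw [h5]
      rcases Int.units_eq_one_or (o (vert G h)) with a | a <;> simp [a, mul_comm, mul_left_comm]
  let F : Γ.Face → Δ.Face := Sum.map (Quot.lift (fun c => Quot.mk _ (m c)) hm)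
    (fun x => ⟨f x.1, hiso x.1 x.2⟩)
  have hF : Function.Surjective F := by
    rintro (q | ⟨x, hx⟩)
    · induction q using Quot.ind with
      | mk c =>
        refine ⟨Sum.inl (Quot.mk _ (φ.symm c.1, o (vert G (φ.symm c.1)) * c.2)), ?_⟩
        simp only [F, m, Sum.map_inl, Equiv.apply_symm_apply]
        rcases Int.units_eq_one_or (o (vert G (φ.symm c.1))) with a | a <;> simp [a] <;> rfl
    · refine ⟨Sum.inr ⟨f.symm x, fun h he => hx (φ h) ?_⟩, ?_⟩
      · rw [h2, he, Equiv.apply_symm_apply]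
      · simp [F]; rfl
  have : Finite Γ.Face := by unfold Face; infer_instance
  have : Finite (Γ.FaceColoring n) := by unfold FaceColoring; infer_instance
  refine Nat.card_le_card_of_injective
    (fun c : Δ.FaceColoring n => (⟨c.1 ∘ F, fun h => ?_⟩ : Γ.FaceColoring n)) ?_
  · have := c.2 (φ h)
    simp only [faceAt] at this
    change c.1 (Sum.inl (Quot.mk _ (φ h, o (vert G h) * 1))) ≠
      c.1 (Sum.inl (Quot.mk _ (φ h, o (vert G h) * -1)))
    rcases Int.units_eq_one_or (o (vert G h)) with a | a
    · simpa [a] using this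
    · simpa [a] using this.symm
  · intro c d hcd
    exact Subtype.ext (hF.injective_comp_right (congrArg Subtype.val hcd))

end Diagram

/-- The ribbon graphs of `G`, up to equivalence. -/
def RibbonGraph (G : Graph α β) : Type v := Quotient (Diagram.setoid G)

namespace RibbonGraph

variable {G : Graph α β}

/-- The ribbon graph presented by a diagram. -/
def mk (Γ : Diagram G) : RibbonGraph G := Quotient.mk _ Γ

instance [Finite E(G)] : Finite (RibbonGraph G) := by
  have : Finite (Diagram G) := by
    refine Finite.of_injective
      (fun Γ : Diagram G => ((Γ.next, Γ.sign) : Equiv.Perm (HalfEdge G) × (E(G) → ℤˣ))) ?_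
    rintro ⟨a, b, c⟩ ⟨a', b', c'⟩ h
    simp only [Prod.mk.injEq] at h
    obtain ⟨rfl, rfl⟩ := h
    rfl
  unfold RibbonGraph
  infer_instance

instance [Finite E(G)] : Fintype (RibbonGraph G) := Fintype.ofFinite _

/-- The number of `n`-face colorings of a ribbon graph. -/
def numFaceColorings [Finite V(G)] [Finite E(G)] (n : ℕ) (R : RibbonGraph G) : ℕ :=
  Quotient.lift (fun Γ : Diagram G => Γ.numFaceColorings n)
    (fun _ _ h => le_antisymm (Diagram.FaceColoring.card_le n (Diagram.Equivalent.symm h))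
      (Diagram.FaceColoring.card_le n h)) R

/-- A ribbon graph is even with respect to `Γ` if it is equivalent to `Γ` after inserting half-twists
into an even number of edges. It is odd with respect to `Γ` if it is not even. -/
def IsEven (Γ : Diagram G) (R : RibbonGraph G) : Prop :=
  ∃ S : Finset E(G), Even S.card ∧ R = mk (Γ.twist S)

end RibbonGraph

/-- `G` is planar: it has a plane ribbon graph. -/
def Planar (G : Graph α β) : Prop := ∃ Γ : Diagram G, Γ.IsPlane

/-! ### The Penrose polynomial -/

namespace Diagram

variable {G : Graph α β}

/-- Whether the state with `1`-smoothings at `S` replaces the edge `e` by crossing strands. At a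
positive edge the `0`-smoothing is a pair of parallel strands and the `1`-smoothing
a pair of crossing strands; at a negative edge they are exchanged. -/
def Crossed (Γ : Diagram G) (S : Finset E(G)) (e : E(G)) : Prop :=
  (Γ.sign e = 1 ∧ e ∈ S) ∨ (Γ.sign e = -1 ∧ e ∉ S)

/-- The strands of a state of the blowup. In the blowup every vertex becomes a circle, through the
half-edges at it in their cyclic order; the half-edge `h` cuts this circle, and `(h, 1)` and
`(h, -1)` are the ends there of the arcs towards the next and from the previous half-edge. The two
smoothings of an edge join the four ends at it in pairs. -/
inductive StateStrand (Γ : Diagram G) (S : Finset E(G)) : Corner G → Corner G → Prop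
  | arc (h : HalfEdge G) : StateStrand Γ S (h, 1) (Γ.next h, -1)
  | parallel (h : HalfEdge G) (ε : ℤˣ) (hc : ¬ Γ.Crossed S h.1) :
      StateStrand Γ S (h, ε) (opp h, -ε)
  | crossing (h : HalfEdge G) (ε : ℤˣ) (hc : Γ.Crossed S h.1) :
      StateStrand Γ S (h, ε) (opp h, ε)

/-- The immersed circles of a state of the blowup. The circle that replaces a vertex without edges
is not cut. -/
def StateCircle (Γ : Diagram G) (S : Finset E(G)) : Type (max u v) :=
  Quot (Γ.StateStrand S) ⊕ {x : V(G) // ∀ h, vert G h ≠ x}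

/-- The Penrose polynomial `P(Γ, n)`: resolve every edge `e` in the blowup by the bracket
`[e] = [0-smoothing] - [1-smoothing]`, and give each circle the value `n`. -/
def penrose [Fintype E(G)] (Γ : Diagram G) : Polynomial ℤ :=
  ∑ S : Finset E(G), (-1) ^ S.card * Polynomial.X ^ Nat.card (Γ.StateCircle S)

/-- The leading coefficient of the Penrose polynomial is positive, or this polynomial is zero. -/
def Nonneg [Fintype E(G)] (Γ : Diagram G) : Prop := 0 ≤ Γ.penrose.leadingCoeff

end Diagram

open scoped Classical in
/-- The Penrose polynomial of an abstract connected trivalent graph: that of any nonnegative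
ribbon diagram of it. -/
def penrose (G : Graph α β) [Fintype E(G)] : Polynomial ℤ :=
  if h : ∃ Γ : Diagram G, Γ.Nonneg then h.choose.penrose else 0

end Ribbon

end

noncomputable section

namespace Ribbon

universe u v

variable {α : Type u} {β : Type v} {G : Graph α β}

/-! The circles of the state `S` are the faces of `Γ.twist S`, so `n ^ k` counts all colorings of
these faces, proper or not. Such a coloring is a coloring of the corners that is constant along the
boundary arcs, and the set of corners is the same for all states. For a fixed corner coloring, sum
over the states compatible with it: if some edge has one color on both sides, changing the smoothing
of that edge keeps compatibility and reverses the sign, so everything cancels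
(`sum_compatible_eq_zero`). Only the proper colorings survive.

On a sphere no odd state has a proper coloring (`IsPlane.even_card`). This is the fact that closed
plane curves of different colors cross evenly: by `IsPlane.exists_faceBoundary_eq` the curves of
each color form a boundary modulo two, and a strand changes sides of that boundary at every
crossing.

At a trivalent vertex there are only two cyclic orders, and reversing the disk exchanges them. So
any two diagrams differ by half-twists up to equivalence (`exists_equivalent_twist`), and each
half-twist negates the polynomial (`penrose_twist`); the leading coefficient then fixes the sign.
With trivial automorphism group and no loops, each ribbon graph arises from exactly one state
(`mk_twist_injective`, `mk_twist_surjective`), so the sum over states is a sum over ribbon graphs. A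
loop can be flipped without moving a vertex or an edge, which breaks this bijection, but then all
counts are zero (`numFaceColorings_eq_zero_of_loop`). -/

@[simp] theorem opp_opp (h : HalfEdge G) : opp (opp h) = h := by simp [opp]

theorem eq_or_eq_opp {h h' : HalfEdge G} (H : h.1 = h'.1) : h = h' ∨ h = opp h' := by
  obtain ⟨e, b⟩ := h
  obtain ⟨e', b'⟩ := h'
  obtain rfl : e = e' := H
  cases b <;> cases b' <;> simp [opp]

namespace Diagram

/-! ### States of the blowup and signed counts of face colorings -/

section Coloring

open scoped Classical

theorem twist_sign (Γ : Diagram G) (S : Finset E(G)) (e : E(G)) :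
    (Γ.twist S).sign e = if e ∈ S then -Γ.sign e else Γ.sign e := rfl

theorem crossed_iff (Γ : Diagram G) (S : Finset E(G)) (e : E(G)) :
    Γ.Crossed S e ↔ (Γ.twist S).sign e = -1 := by
  rcases Int.units_eq_one_or (Γ.sign e) with a | a <;> by_cases hs : e ∈ S <;>
    simp [Crossed, twist_sign, a, hs]

/-- Crossing strands are the two sides of a half-twisted band, parallel strands those of a flat one,
and `S` crosses exactly the edges that are negative after twisting. -/
theorem stateStrand_eq (Γ : Diagram G) (S : Finset E(G)) :
    Γ.StateStrand S = (Γ.twist S).BoundaryArc := by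
  ext c d
  constructor
  · rintro (⟨h⟩ | ⟨h, ε, hc⟩ | ⟨h, ε, hc⟩)
    · exact BoundaryArc.disk (Γ := Γ.twist S) h
    · rw [crossed_iff] at hc
      have := BoundaryArc.band (Γ := Γ.twist S) h ε
      rwa [(Int.units_eq_one_or _).resolve_right hc, one_mul] at this
    · rw [crossed_iff] at hc
      have := BoundaryArc.band (Γ := Γ.twist S) h ε
      rwa [hc, neg_one_mul, neg_neg] at this
  · rintro (⟨h⟩ | ⟨h, ε⟩)
    · exact StateStrand.arc h
    · by_cases hc : Γ.Crossed S h.1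
      · rw [(crossed_iff _ _ _).1 hc, neg_one_mul, neg_neg]
        exact StateStrand.crossing h ε hc
      · rw [(Int.units_eq_one_or _).resolve_right (mt (crossed_iff _ _ _).2 hc), one_mul]
        exact StateStrand.parallel h ε hc

theorem stateCircle_eq (Γ : Diagram G) (S : Finset E(G)) :
    Γ.StateCircle S = (Γ.twist S).Face := by
  rw [StateCircle, stateStrand_eq, Face]

/-- A coloring of the corners that is constant along the boundary of the ribbon surface. -/
def Compatible (Γ : Diagram G) {n : ℕ} (c : Corner G → Fin n) : Prop :=
  ∀ x y, Γ.BoundaryArc x y → c x = c y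

/-- The two sides of every half-edge have different colors. -/
def Proper {n : ℕ} (c : Corner G → Fin n) : Prop :=
  ∀ h : HalfEdge G, c (h, 1) ≠ c (h, -1)

/-- Colorings of the faces as colorings of the corners and of the isolated vertices. -/
def faceFunctionEquiv (Γ : Diagram G) (n : ℕ) (Q : (Corner G → Fin n) → Prop) :
    {c : Γ.Face → Fin n // Q (fun x => c (Γ.faceAt x))} ≃
      {c : Corner G → Fin n // Γ.Compatible c ∧ Q c} ×
        ({x : V(G) // ∀ h, vert G h ≠ x} → Fin n) where
  toFun c := (⟨fun x => c.1 (Γ.faceAt x),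
    fun _ _ hxy => congrArg (fun q => c.1 (Sum.inl q)) (Quot.sound hxy), c.2⟩,
    fun x => c.1 (Sum.inr x))
  invFun p := ⟨Sum.elim (Quot.lift p.1.1 p.1.2.1) p.2, p.1.2.2⟩
  left_inv c := by
    apply Subtype.ext
    funext q
    rcases q with q | x
    · induction q using Quot.ind
      rfl
    · rfl
  right_inv _ := rfl

/-- All four corners at the edge get the same color, so either way of joining them is compatible. -/
theorem Compatible.toggle {Γ : Diagram G} {n : ℕ} {c : Corner G → Fin n} {h : HalfEdge G}
    (hc : c (h, 1) = c (h, -1)) {S : Finset E(G)} (H : (Γ.twist S).Compatible c) :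
    (Γ.twist (symmDiff S {h.1})).Compatible c := by
  have hb : ∀ ε, c (h, ε) = c (h, 1) := fun ε => by
    rcases Int.units_eq_one_or ε with rfl | rfl <;> simp [hc]
  have ho : ∀ ε, c (opp h, ε) = c (h, 1) := fun ε => by
    rw [H _ _ (BoundaryArc.band (Γ := Γ.twist S) (opp h) ε), opp_opp, hb]
  rintro x y (⟨k⟩ | ⟨k, ε⟩)
  · exact H _ _ (BoundaryArc.disk (Γ := Γ.twist S) k)
  · by_cases hk : k.1 = h.1
    · rcases eq_or_eq_opp hk with rfl | rfl
      · rw [hb, ho]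
      · rw [ho, opp_opp]
        exact (hb _).symm
    · have := H _ _ (BoundaryArc.band (Γ := Γ.twist S) k ε)
      rw [this]
      simp [twist_sign, Finset.mem_symmDiff, hk]

theorem neg_one_pow_card_symmDiff {ι : Type*} [DecidableEq ι] (S T : Finset ι) :
    (-1 : ℤ) ^ (symmDiff S T).card = (-1) ^ S.card * (-1) ^ T.card := by
  have h1 : (symmDiff S T).card = (S \ T).card + (T \ S).card := by
    rw [symmDiff_def, Finset.sup_eq_union,
      Finset.card_union_of_disjoint (by exact disjoint_sdiff_sdiff)]
  have h2 := Finset.card_sdiff_add_card_inter S T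
  have h3 := Finset.card_sdiff_add_card_inter T S
  rw [Finset.inter_comm] at h3
  rw [h1, ← pow_add, ← h2, ← h3,
    show (S \ T).card + (S ∩ T).card + ((T \ S).card + (S ∩ T).card) =
      (S \ T).card + (T \ S).card + 2 * (S ∩ T).card by ring, pow_add _ _ (2 * _), pow_mul]
  simp

/-- Toggling one fixed edge with equal colors on its sides is a sign-reversing involution on the
compatible states. -/
theorem sum_compatible_eq_zero [Fintype E(G)] (Γ : Diagram G) {n : ℕ} {c : Corner G → Fin n}
    (hc : ¬ Proper c) :
    ∑ S : Finset E(G), (-1 : ℤ) ^ S.card * (if (Γ.twist S).Compatible c then 1 else 0) = 0 := by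
  simp only [Proper, not_forall, not_not] at hc
  obtain ⟨h, hh⟩ := hc
  refine Finset.sum_involution (fun S _ => symmDiff S {h.1}) ?_ ?_ (by simp) (by simp)
  · intro S _
    have : (Γ.twist (symmDiff S {h.1})).Compatible c ↔ (Γ.twist S).Compatible c :=
      ⟨fun H => by simpa using H.toggle hh, fun H => H.toggle hh⟩
    rw [neg_one_pow_card_symmDiff, Finset.card_singleton]
    simp only [this]
    ring
  · intro S _ _ H
    simp at H

variable [Fintype V(G)] [Fintype E(G)]

instance (Γ : Diagram G) : Finite Γ.Face := by unfold Face; infer_instance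

/-- The disks of isolated vertices contribute a separate factor, which does not depend on the signs
and so is common to all states. -/
theorem card_faceFunction (Γ : Diagram G) (n : ℕ) (Q : (Corner G → Fin n) → Prop) :
    (Nat.card {c : Γ.Face → Fin n // Q (fun x => c (Γ.faceAt x))} : ℤ) =
      (∑ c : Corner G → Fin n, if Γ.Compatible c ∧ Q c then 1 else 0) *
        Nat.card ({x : V(G) // ∀ h, vert G h ≠ x} → Fin n) := by
  rw [Nat.card_congr (faceFunctionEquiv Γ n Q), Nat.card_prod, Nat.cast_mul,
    Nat.card_eq_fintype_card (α := {c : Corner G → Fin n // _}), Fintype.card_subtype]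
  simp

theorem numFaceColorings_eq (Γ : Diagram G) (n : ℕ) :
    (Γ.numFaceColorings n : ℤ) =
      (∑ c : Corner G → Fin n, if Γ.Compatible c ∧ Proper c then 1 else 0) *
        Nat.card ({x : V(G) // ∀ h, vert G h ≠ x} → Fin n) :=
  card_faceFunction Γ n Proper

theorem pow_card_face (Γ : Diagram G) (n : ℕ) :
    (n : ℤ) ^ Nat.card Γ.Face =
      (∑ c : Corner G → Fin n, if Γ.Compatible c then 1 else 0) *
        Nat.card ({x : V(G) // ∀ h, vert G h ≠ x} → Fin n) := by
  have h := card_faceFunction Γ n (fun _ => True)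
  simp only [and_true] at h
  rw [← h, Nat.card_congr (Equiv.subtypeUnivEquiv fun _ => trivial), Nat.card_fun, Nat.card_fin,
    Nat.cast_pow]

/-- The Penrose polynomial as a signed count of face colorings. -/
theorem penrose_eval_eq_sum (Γ : Diagram G) (n : ℕ) :
    Γ.penrose.eval (n : ℤ) =
      ∑ S : Finset E(G), (-1) ^ S.card * ((Γ.twist S).numFaceColorings n : ℤ) := by
  simp only [penrose, Polynomial.eval_finsetSum, Polynomial.eval_mul, Polynomial.eval_pow,
    Polynomial.eval_neg, Polynomial.eval_one, Polynomial.eval_X, stateCircle_eq, pow_card_face,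
    numFaceColorings_eq]
  simp only [← mul_assoc, ← Finset.sum_mul]
  congr 1
  simp only [Finset.mul_sum]
  -- Corner colorings do not depend on the state, so they can be summed over last.
  rw [Finset.sum_comm, Finset.sum_comm (s := (Finset.univ : Finset (Finset E(G))))]
  refine Finset.sum_congr rfl fun c _ => ?_
  by_cases hc : Proper c
  · simp [hc]
  · simpa [hc] using sum_compatible_eq_zero Γ hc

theorem penrose_eval (Γ : Diagram G) (n : ℕ) :
    Γ.penrose.eval (n : ℤ) =
      (∑ S : Finset E(G) with Even S.card, ((Γ.twist S).numFaceColorings n : ℤ))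
        - ∑ S : Finset E(G) with ¬ Even S.card, ((Γ.twist S).numFaceColorings n : ℤ) := by
  rw [penrose_eval_eq_sum, ← Finset.sum_filter_add_sum_filter_not _ (fun S => Even S.card),
    sub_eq_add_neg, ← Finset.sum_neg_distrib]
  congr 1 <;> refine Finset.sum_congr rfl fun S hS => ?_
  · rw [(Finset.mem_filter.1 hS).2.neg_one_pow, one_mul]
  · rw [(Nat.not_even_iff_odd.1 (Finset.mem_filter.1 hS).2).neg_one_pow, neg_one_mul]

end Coloring

end Diagram

/-! ### Connectedness: functions on faces that do not change across edges -/

theorem exists_halfEdge_of_adj {x y : α} (H : G.Adj x y) :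
    ∃ h : HalfEdge G, (vert G h : α) = x ∧ (vert G (opp h) : α) = y := by
  obtain ⟨e, he⟩ := H
  have h := isLink_vert G ⟨e, he.edge_mem⟩
  rcases h.eq_and_eq_or_eq_and_eq he with ⟨h1, h2⟩ | ⟨h1, h2⟩
  · exact ⟨(⟨e, he.edge_mem⟩, false), h1, h2⟩
  · exact ⟨(⟨e, he.edge_mem⟩, true), h2, h1⟩

namespace Diagram

theorem faceAt_disk (Γ : Diagram G) (h : HalfEdge G) :
    Γ.faceAt (Γ.next h, -1) = Γ.faceAt (h, 1) :=
  congrArg Sum.inl (Quot.sound (BoundaryArc.disk h)).symm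

theorem faceAt_band (Γ : Diagram G) (h : HalfEdge G) (ε : ℤˣ) :
    Γ.faceAt (opp h, -(Γ.sign h.1 * ε)) = Γ.faceAt (h, ε) :=
  congrArg Sum.inl (Quot.sound (BoundaryArc.band h ε)).symm

/-- The vertex `x` lies on the boundary of the face. -/
def Touches (Γ : Diagram G) (x : α) (F : Γ.Face) : Prop :=
  (∃ h ε, (vert G h : α) = x ∧ F = Γ.faceAt (h, ε)) ∨ ∃ y, (y.1 : α) = x ∧ F = Sum.inr y

theorem exists_touches (Γ : Diagram G) (F : Γ.Face) : ∃ x : V(G), Γ.Touches x F := by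
  rcases F with q | y
  · induction q using Quot.ind with
    | mk c => exact ⟨vert G c.1, Or.inl ⟨c.1, c.2, rfl, rfl⟩⟩
  · exact ⟨y.1, Or.inr ⟨y, rfl, rfl⟩⟩

section EdgeInvariant

variable {γ : Type*} {Γ : Diagram G} {f : Γ.Face → γ}

/-- Going around a vertex, one alternately stays in a face along a disk arc and crosses a band,
where the value does not change. -/
theorem eq_of_vert_eq (hf : ∀ h, f (Γ.faceAt (h, 1)) = f (Γ.faceAt (h, -1))) {h h' : HalfEdge G}
    (H : vert G h = vert G h') (ε ε' : ℤˣ) : f (Γ.faceAt (h, ε)) = f (Γ.faceAt (h', ε')) := by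
  have key : ∀ h (ε : ℤˣ), f (Γ.faceAt (h, ε)) = f (Γ.faceAt (h, 1)) := fun h ε => by
    rcases Int.units_eq_one_or ε with rfl | rfl <;> simp [hf]
  have next : ∀ h, f (Γ.faceAt (Γ.next h, 1)) = f (Γ.faceAt (h, 1)) := fun h => by
    rw [hf, faceAt_disk]
  rw [key h, key h']
  obtain ⟨i, rfl⟩ := (Γ.sameCycle_iff h h').2 H
  clear H
  induction i with
  | zero => rfl
  | succ i ih => rw [add_comm, zpow_add, zpow_one, Equiv.Perm.mul_apply, next, ih]
  | pred i ih =>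
    rw [ih, ← next ((Γ.next ^ (-(i : ℤ) - 1)) h), ← Equiv.Perm.mul_apply, ← zpow_one_add]
    congr 5
    ring

/-- A side of a band belongs to one face, which touches both ends of the edge; this carries the
value along a walk. -/
theorem eq_of_touches (hf : ∀ h, f (Γ.faceAt (h, 1)) = f (Γ.faceAt (h, -1))) {x y : α}
    (H : Relation.ReflTransGen G.Adj x y) {F F' : Γ.Face} (hF : Γ.Touches x F)
    (hF' : Γ.Touches y F') : f F = f F' := by
  have base : ∀ x F F', Γ.Touches x F → Γ.Touches x F' → f F = f F' := by
    rintro x _ _ (⟨h, ε, hx, rfl⟩ | ⟨z, hx, rfl⟩) (⟨h', ε', hx', rfl⟩ | ⟨z', hx', rfl⟩)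
    · exact eq_of_vert_eq hf (Subtype.ext (hx.trans hx'.symm)) _ _
    · exact absurd (Subtype.ext (hx.trans hx'.symm)) (z'.2 h)
    · exact absurd (Subtype.ext (hx'.trans hx.symm)) (z.2 h')
    · rw [Subtype.ext (Subtype.ext (hx.trans hx'.symm))]
  induction H generalizing F' with
  | refl => exact base _ _ _ hF hF'
  | tail _ hadj ih =>
    obtain ⟨h, h1, h2⟩ := exists_halfEdge_of_adj hadj
    rw [ih (F' := Γ.faceAt (h, 1)) (Or.inl ⟨h, 1, h1, rfl⟩), ← faceAt_band]
    exact base _ _ _ (Or.inl ⟨opp h, _, h2, rfl⟩) hF'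

theorem eq_of_connected (hG : Connected G)
    (hf : ∀ h, f (Γ.faceAt (h, 1)) = f (Γ.faceAt (h, -1))) (F F' : Γ.Face) : f F = f F' := by
  obtain ⟨x, hx⟩ := Γ.exists_touches F
  obtain ⟨y, hy⟩ := Γ.exists_touches F'
  exact eq_of_touches hf (hG.2 _ x.2 _ y.2) hx hy

end EdgeInvariant

/-! ### Homology modulo two and the plane case -/

section Homology

open scoped Classical

/-- The boundary map from edges to vertices, modulo two. -/
def edgeBoundary (G : Graph α β) [Fintype V(G)] [Fintype E(G)] :
    (E(G) → ZMod 2) →ₗ[ZMod 2] (V(G) → ZMod 2) where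
  toFun z x := ∑ h : HalfEdge G with vert G h = x, z h.1
  map_add' z w := by
    funext x
    simp [Finset.sum_add_distrib]
  map_smul' a z := by
    funext x
    simp [Finset.mul_sum]

/-- The boundary map from faces to edges, modulo two. -/
def faceBoundary (Γ : Diagram G) : (Γ.Face → ZMod 2) →ₗ[ZMod 2] (E(G) → ZMod 2) where
  toFun f e := f (Γ.faceAt ((e, false), 1)) + f (Γ.faceAt ((e, false), -1))
  map_add' f g := by
    funext e
    simp only [Pi.add_apply]
    ring
  map_smul' a f := by
    funext x
    simp [mul_add]

theorem faceBoundary_apply (Γ : Diagram G) (f : Γ.Face → ZMod 2) (h : HalfEdge G) :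
    Γ.faceBoundary f h.1 = f (Γ.faceAt (h, 1)) + f (Γ.faceAt (h, -1)) := by
  rcases eq_or_eq_opp (h := h) (h' := (h.1, false)) rfl with H | H
  · rw [H]
    rfl
  · have h1 := Γ.faceAt_band (h.1, false) 1
    have h2 := Γ.faceAt_band (h.1, false) (-1)
    rw [← H] at h1 h2
    change f (Γ.faceAt ((h.1, false), 1)) + f (Γ.faceAt ((h.1, false), -1)) = _
    rw [← h1, ← h2]
    rcases Int.units_eq_one_or (Γ.sign h.1) with a | a <;> simp [a, add_comm]

/-- The disk arcs pair the corners at the chosen vertices, with equal values in each pair. -/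
theorem sum_corners_eq_zero [Fintype E(G)] (Γ : Diagram G) (P : HalfEdge G → Prop)
    [DecidablePred P]
    (hP : ∀ h, P (Γ.next h) ↔ P h) (F : Corner G → ZMod 2)
    (hF : ∀ h, F (Γ.next h, -1) = F (h, 1)) :
    ∑ h : HalfEdge G with P h, (F (h, 1) + F (h, -1)) = 0 := by
  rw [Finset.sum_add_distrib]
  have : ∑ h : HalfEdge G with P h, F (h, -1) = ∑ h : HalfEdge G with P h, F (h, 1) := by
    symm
    refine Finset.sum_equiv Γ.next (by simp [hP]) fun h _ => (hF h).symm
  rw [this, CharTwo.add_self_eq_zero]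

variable [Fintype V(G)] [Fintype E(G)]

/-- This serves twice: for boundaries of faces, and for the curves of one color in a state. -/
theorem edgeBoundary_eq_zero (Γ : Diagram G) (F : Corner G → ZMod 2)
    (hF : ∀ h, F (Γ.next h, -1) = F (h, 1)) (z : E(G) → ZMod 2)
    (hz : ∀ h : HalfEdge G, z h.1 = F (h, 1) + F (h, -1)) : edgeBoundary G z = 0 := by
  funext x
  change ∑ h : HalfEdge G with vert G h = x, z h.1 = 0
  simp only [hz]
  exact Γ.sum_corners_eq_zero (fun h => vert G h = x) (fun h => by rw [vert_next]) F hF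

theorem single_sub_single_mem_range (h : HalfEdge G) :
    (Pi.single (vert G h) 1 - Pi.single (vert G (opp h)) 1 : V(G) → ZMod 2) ∈
      LinearMap.range (edgeBoundary G) := by
  refine ⟨Pi.single h.1 1, ?_⟩
  funext x
  change ∑ k : HalfEdge G with vert G k = x, (Pi.single h.1 1 : E(G) → ZMod 2) k.1 = _
  rw [Finset.sum_filter, Fintype.sum_prod_type, Finset.sum_eq_single h.1]
  · obtain ⟨e, b⟩ := h
    cases b <;> simp only [Fintype.sum_bool, Pi.single_eq_same, Pi.sub_apply, Pi.single_apply, opp,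
      CharTwo.sub_eq_add, eq_comm, add_comm, Bool.not_true, Bool.not_false]
  · intro e _ he
    simp [he]
  · simp

/-- Modulo boundaries of edges, all vertices of a connected graph are equal, so one more vector
spans the whole space. -/
theorem card_vertices_le (hG : Connected G) :
    Fintype.card V(G) ≤ Module.finrank (ZMod 2) (LinearMap.range (edgeBoundary G)) + 1 := by
  obtain ⟨x₀, hx₀⟩ := hG.1
  set R := LinearMap.range (edgeBoundary G)
  set w : V(G) → ZMod 2 := Pi.single ⟨x₀, hx₀⟩ 1
  have key : ∀ y, Relation.ReflTransGen G.Adj x₀ y → ∀ hy : y ∈ V(G),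
      (w - Pi.single ⟨y, hy⟩ 1 : V(G) → ZMod 2) ∈ R := by
    intro y H
    induction H with
    | refl => intro hy; simp [w]
    | tail _ hadj ih =>
      intro hy
      obtain ⟨h, rfl, rfl⟩ := exists_halfEdge_of_adj hadj
      simpa using add_mem (ih (vert G h).2) (single_sub_single_mem_range h)
  have top : (⊤ : Submodule (ZMod 2) (V(G) → ZMod 2)) ≤ R ⊔ Submodule.span _ {w} := by
    rw [← (Pi.basisFun (ZMod 2) V(G)).span_eq, Submodule.span_le]
    rintro _ ⟨y, rfl⟩
    rw [Pi.basisFun_apply]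
    have := sub_mem (Submodule.mem_sup_right (S := R)
      (Submodule.mem_span_singleton_self (R := ZMod 2) w))
      (Submodule.mem_sup_left (key y (hG.2 _ hx₀ _ y.2) y.2))
    simpa using this
  calc Fintype.card V(G) = Module.finrank (ZMod 2) (⊤ : Submodule (ZMod 2) (V(G) → ZMod 2)) := by
        rw [finrank_top, Module.finrank_fintype_fun_eq_card]
    _ ≤ _ := Submodule.finrank_mono top
    _ ≤ _ := Submodule.finrank_add_le_finrank_add_finrank _ _
    _ ≤ _ := by gcongr; exact (finrank_span_le_card {w}).trans (by simp)

/-- By connectedness the kernel contains only the constants. -/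
theorem card_faces_le (hG : Connected G) (Γ : Diagram G) :
    Nat.card Γ.Face ≤ Module.finrank (ZMod 2) (LinearMap.range Γ.faceBoundary) + 1 := by
  have : Fintype Γ.Face := Fintype.ofFinite _
  have hker : LinearMap.ker Γ.faceBoundary ≤ Submodule.span (ZMod 2) {fun _ => 1} := by
    intro f hf
    rw [LinearMap.mem_ker] at hf
    rcases isEmpty_or_nonempty Γ.Face with hE | ⟨⟨F₀⟩⟩
    · rw [Subsingleton.elim f 0]
      exact zero_mem _
    refine Submodule.mem_span_singleton.2 ⟨f F₀, funext fun F => ?_⟩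
    rw [Pi.smul_apply, smul_eq_mul, mul_one]
    refine eq_of_connected hG (fun h => ?_) F₀ F
    have := Γ.faceBoundary_apply f h
    rw [hf] at this
    exact CharTwo.add_eq_zero.1 this.symm
  have h1 := LinearMap.finrank_range_add_finrank_ker Γ.faceBoundary
  have h2 := (Submodule.finrank_mono hker).trans (finrank_span_le_card _)
  rw [Set.toFinset_card, Fintype.card_unique] at h2
  rw [Module.finrank_fintype_fun_eq_card] at h1
  rw [Nat.card_eq_fintype_card]
  omega

/-- On a sphere every cycle modulo two is a boundary. -/
theorem IsPlane.exists_faceBoundary_eq (hG : Connected G) {Γ : Diagram G} (hΓ : Γ.IsPlane)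
    {z : E(G) → ZMod 2} (hz : edgeBoundary G z = 0) : ∃ f, Γ.faceBoundary f = z := by
  have hle : LinearMap.range Γ.faceBoundary ≤ LinearMap.ker (edgeBoundary G) := by
    rintro _ ⟨f, rfl⟩
    exact Γ.edgeBoundary_eq_zero (fun c => f (Γ.faceAt c)) (fun h => by rw [faceAt_disk]) _
      (Γ.faceBoundary_apply f)
  have h1 := LinearMap.finrank_range_add_finrank_ker (edgeBoundary G)
  rw [Module.finrank_fintype_fun_eq_card] at h1
  have h2 := card_vertices_le hG
  have h3 := card_faces_le hG Γ
  have h4 : (Nat.card V(G) : ℤ) - Nat.card E(G) + Nat.card Γ.Face = 2 := hΓ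
  rw [Nat.card_eq_fintype_card (α := V(G)), Nat.card_eq_fintype_card (α := E(G))] at h4
  -- Euler characteristic two makes the lower bound `|F| - 1` for the rank of the boundaries meet
  -- the upper bound `|E| - |V| + 1` for the dimension of the cycles.
  have := Submodule.eq_of_le_of_finrank_le hle (by omega)
  exact LinearMap.mem_range.1 (this ▸ LinearMap.mem_ker.2 hz)

/-- Curves of different colors in the plane cross an even number of times. -/
theorem IsPlane.even_card (hG : Connected G) {Γ : Diagram G} (hΓ : Γ.IsPlane) {n : ℕ}
    {S : Finset E(G)} {c : Corner G → Fin n} (hc : (Γ.twist S).Compatible c) (hp : Proper c) :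
    Even S.card := by
  have cdisk : ∀ h, c (Γ.next h, -1) = c (h, 1) := fun h =>
    (hc _ _ (BoundaryArc.disk (Γ := Γ.twist S) h)).symm
  have cband : ∀ h ε, c (opp h, -((Γ.twist S).sign h.1 * ε)) = c (h, ε) := fun h ε =>
    (hc _ _ (BoundaryArc.band (Γ := Γ.twist S) h ε)).symm
  let ind : Fin n → Corner G → ZMod 2 := fun i x => if c x = i then 1 else 0
  -- The strands of color `i` form a cycle modulo two, hence a boundary: `f` labels the faces of the
  -- untwisted `Γ` and changes across an edge exactly when one of its two strands has color `i`.
  have hz : ∀ i, ∃ f : Γ.Face → ZMod 2, ∀ h : HalfEdge G,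
      f (Γ.faceAt (h, 1)) + f (Γ.faceAt (h, -1)) = ind i (h, 1) + ind i (h, -1) := by
    intro i
    let z : E(G) → ZMod 2 := fun e => ind i ((e, false), 1) + ind i ((e, false), -1)
    have hz : ∀ h : HalfEdge G, z h.1 = ind i (h, 1) + ind i (h, -1) := by
      intro h
      rcases eq_or_eq_opp (h := h) (h' := (h.1, false)) rfl with H | H
      · rw [H]
      · have h1 := cband (h.1, false) 1
        have h2 := cband (h.1, false) (-1)
        rw [← H] at h1 h2
        simp only [z, ind]
        rw [← h1, ← h2]
        rcases Int.units_eq_one_or ((Γ.twist S).sign h.1) with a | a <;> simp [a, add_comm]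
    obtain ⟨f, hf⟩ := hΓ.exists_faceBoundary_eq hG
      (Γ.edgeBoundary_eq_zero (ind i) (fun h => by simp only [ind, cdisk]) z hz)
    exact ⟨f, fun h => by rw [← faceBoundary_apply, hf, hz]⟩
  choose f hf using hz
  -- The labels of the current face with respect to all colors smaller than that of the strand.
  -- Restricting to smaller colors makes each crossing count once. The sum of `Φ` over all corners
  -- vanishes when grouped by disk arcs, and equals `S.card` modulo two when grouped by edges.
  let Φ : Corner G → ZMod 2 := fun x => ∑ i with i < c x, f i (Γ.faceAt x)
  have h0 : ∑ h : HalfEdge G, (Φ (h, 1) + Φ (h, -1)) = 0 := by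
    simpa using Γ.sum_corners_eq_zero (fun _ => True) (by simp) Φ
      (fun h => by simp only [Φ, cdisk, faceAt_disk])
  have hpair : ∀ h : HalfEdge G, h.1 ∉ S → ∀ ε, Φ (opp h, -(Γ.sign h.1 * ε)) = Φ (h, ε) := by
    intro h hh ε
    have := cband h ε
    rw [twist_sign, if_neg hh] at this
    simp only [Φ, this, faceAt_band]
  -- At a crossing the strand passes to the face of `Γ` on the other side of the edge. Its own color
  -- is not smaller than itself, so only the color of the other strand can contribute.
  have hcross : ∀ h : HalfEdge G, h.1 ∈ S → ∀ ε, Φ (h, ε) + Φ (opp h, Γ.sign h.1 * ε) =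
      if c (h, -ε) < c (h, ε) then 1 else 0 := by
    intro h hh ε
    have h1 := cband h ε
    rw [twist_sign, if_pos hh, neg_mul, neg_neg] at h1
    have h2 := Γ.faceAt_band h (-ε)
    rw [mul_neg, neg_neg] at h2
    have h3 : ∀ i, f i (Γ.faceAt (h, ε)) + f i (Γ.faceAt (h, -ε)) =
        ind i (h, ε) + ind i (h, -ε) := by
      intro i
      rcases Int.units_eq_one_or ε with rfl | rfl
      · exact hf i h
      · rw [neg_neg, add_comm, hf, add_comm]
    simp only [Φ, h1, h2, ← Finset.sum_add_distrib, h3]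
    simp only [ind, Finset.sum_add_distrib, Finset.sum_ite_eq, Finset.mem_filter,
      Finset.mem_univ, true_and, lt_irrefl, if_false, zero_add]
  have hedge : ∀ e : E(G), Φ ((e, false), 1) + Φ ((e, false), -1) +
      (Φ ((e, true), 1) + Φ ((e, true), -1)) = if e ∈ S then 1 else 0 := by
    intro e
    have ho : opp (G := G) (e, false) = (e, true) := rfl
    split_ifs with he
    · have h1 := hcross (e, false) he 1
      have h2 := hcross (e, false) he (-1)
      -- The two colors differ, so exactly one strand sees a smaller color on the other.
      have h3 : (if c ((e, false), -1) < c ((e, false), 1) then 1 else 0 : ZMod 2) +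
          (if c ((e, false), - -1) < c ((e, false), -1) then 1 else 0) = 1 := by
        rw [neg_neg]
        rcases lt_or_gt_of_ne (hp (e, false)) with H | H <;> simp [H, H.not_gt]
      rw [← h3, ← h1, ← h2, ho]
      rcases Int.units_eq_one_or (Γ.sign e) with a | a <;> simp only [a] <;> norm_num <;> ring
    · have h1 := hpair (e, false) he 1
      have h2 := hpair (e, false) he (-1)
      rw [← h1, ← h2, ho]
      rcases Int.units_eq_one_or (Γ.sign e) with a | a <;> simp only [a] <;> norm_num
      · rw [add_comm (Φ _), CharTwo.add_self_eq_zero]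
      · rw [CharTwo.add_self_eq_zero]
  rw [Fintype.sum_prod_type] at h0
  simp only [Fintype.sum_bool] at h0
  rw [Finset.sum_congr rfl fun e _ => (add_comm _ _).trans (hedge e)] at h0
  simpa [ZMod.natCast_eq_zero_iff_even] using h0

theorem IsPlane.penrose_eval (hG : Connected G) {Γ : Diagram G} (hΓ : Γ.IsPlane) (n : ℕ) :
    Γ.penrose.eval (n : ℤ) = ∑ S : Finset E(G), ((Γ.twist S).numFaceColorings n : ℤ) := by
  rw [penrose_eval_eq_sum]
  refine Finset.sum_congr rfl fun S _ => ?_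
  by_cases hS : Even S.card
  · rw [hS.neg_one_pow, one_mul]
  · have : ∀ c : Corner G → Fin n, ¬ ((Γ.twist S).Compatible c ∧ Proper c) :=
      fun c hc => hS (hΓ.even_card hG hc.1 hc.2)
    simp [numFaceColorings_eq, this]

end Homology

end Diagram

/-! ### Half-edges of a multigraph and existence of diagrams -/

theorem isLink_iff (e : E(G)) (x y : V(G)) :
    G.IsLink e x y ↔ ∃ b, vert G (e, b) = x ∧ vert G (e, !b) = y := by
  have h := isLink_vert G e
  constructor
  · intro H
    rcases h.eq_and_eq_or_eq_and_eq H with ⟨h1, h2⟩ | ⟨h1, h2⟩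
    · exact ⟨false, Subtype.ext h1, Subtype.ext h2⟩
    · exact ⟨true, Subtype.ext h2, Subtype.ext h1⟩
  · rintro ⟨b, rfl, rfl⟩
    cases b
    · exact h
    · exact h.symm

/-- For the sets of edges whose first, respectively second, half is at `x`, the union is the set of
incident edges and the intersection the set of loops. -/
theorem encard_halfEdges (x : V(G)) :
    {h : HalfEdge G | vert G h = x}.encard =
      (G.incidenceSet x).encard + (G.loopSet x).encard := by
  let A (b : Bool) : Set E(G) := {e | vert G (e, b) = x}
  have hsplit : {h : HalfEdge G | vert G h = x} =
      (fun e => (e, false)) '' A false ∪ (fun e => (e, true)) '' A true := by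
    ext ⟨e, b⟩
    cases b <;> simp [A]
  have hdisj : Disjoint ((fun e => ((e, false) : HalfEdge G)) '' A false)
      ((fun e => (e, true)) '' A true) := by
    rw [Set.disjoint_left]
    rintro _ ⟨e, -, rfl⟩ ⟨e', -, h⟩
    simp at h
  have hinc : G.incidenceSet x = Subtype.val '' (A false ∪ A true) := by
    ext e
    simp only [Graph.incidenceSet, Set.mem_ofPred_eq, Set.mem_image, Set.mem_union, A]
    constructor
    · rintro ⟨y, hy⟩
      obtain ⟨b, hb, -⟩ := (isLink_iff ⟨e, hy.edge_mem⟩ x ⟨y, hy.right_mem⟩).1 hy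
      refine ⟨⟨e, hy.edge_mem⟩, ?_, rfl⟩
      cases b
      · exact Or.inl hb
      · exact Or.inr hb
    · rintro ⟨e, he | he, rfl⟩
      · exact ⟨_, (isLink_iff e x _).2 ⟨false, he, rfl⟩⟩
      · exact ⟨_, (isLink_iff e x _).2 ⟨true, he, rfl⟩⟩
  have hloop : G.loopSet x = Subtype.val '' (A false ∩ A true) := by
    ext e
    simp only [Graph.loopSet, Set.mem_ofPred_eq, Set.mem_image, Set.mem_inter_iff, A]
    constructor
    · intro hy
      obtain ⟨b, hb, hb'⟩ := (isLink_iff ⟨e, Graph.IsLink.edge_mem hy⟩ x x).1 hy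
      refine ⟨⟨e, Graph.IsLink.edge_mem hy⟩, ?_, rfl⟩
      cases b
      · exact ⟨hb, hb'⟩
      · exact ⟨hb', hb⟩
    · rintro ⟨e, he, rfl⟩
      exact (isLink_iff e x x).2 ⟨false, he⟩
  rw [hsplit, Set.encard_union_eq hdisj,
    Function.Injective.encard_image (fun _ _ h => by simpa using h),
    Function.Injective.encard_image (fun _ _ h => by simpa using h), hinc, hloop,
    Subtype.val_injective.encard_image, Subtype.val_injective.encard_image,
    Set.encard_union_add_encard_inter]

theorem Trivalent.encard_halfEdges (hT : Trivalent G) (x : V(G)) :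
    {h : HalfEdge G | vert G h = x}.encard = 3 :=
  (Ribbon.encard_halfEdges x).trans (hT x x.2)

theorem Trivalent.nonempty_halfEdge (hT : Trivalent G) (x : V(G)) :
    ∃ h : HalfEdge G, vert G h = x := by
  have : {h : HalfEdge G | vert G h = x}.Nonempty := by
    rw [← Set.encard_ne_zero, hT.encard_halfEdges]
    norm_num
  exact this

/-- Every finite graph has a ribbon diagram. -/
theorem Diagram.nonempty [Finite E(G)] : Nonempty (Diagram G) := by
  classical
  have := Fintype.ofFinite E(G)
  choose F hF _ using fun x : V(G) =>
    (Finset.univ.filter fun h : HalfEdge G => vert G h = x).exists_cycleOn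
  have hmem : ∀ x h, h ∈ (↑(Finset.univ.filter fun h : HalfEdge G => vert G h = x) : Set _) ↔
      vert G h = x := by simp
  have hv : ∀ h, vert G (F (vert G h) h) = vert G h := fun h =>
    (hmem _ _).1 ((hF _).1.mapsTo ((hmem _ _).2 rfl))
  have hv' : ∀ h, vert G ((F (vert G h)).symm h) = vert G h := fun h => by
    obtain ⟨k, hk, hkh⟩ := (hF (vert G h)).1.surjOn ((hmem _ h).2 rfl)
    rw [(Equiv.symm_apply_eq _).2 hkh.symm]
    exact (hmem _ _).1 hk
  -- Each chosen cycle preserves the half-edges at its own vertex, so the cycles glue to one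
  -- permutation.
  let next : Equiv.Perm (HalfEdge G) :=
    { toFun := fun h => F (vert G h) h
      invFun := fun h => (F (vert G h)).symm h
      left_inv := fun h => by simp only [hv, Equiv.symm_apply_apply]
      right_inv := fun h => by simp only [hv', Equiv.apply_symm_apply] }
  have hpow : ∀ (i : ℕ) h, (next ^ i) h = (F (vert G h) ^ i) h ∧
      vert G ((next ^ i) h) = vert G h := by
    intro i h
    induction i with
    | zero => simp
    | succ i ih =>
      rw [pow_succ', pow_succ', Equiv.Perm.mul_apply, Equiv.Perm.mul_apply, ← ih.1]
      change F (vert G ((next ^ i) h)) _ = _ ∧ vert G (F (vert G ((next ^ i) h)) _) = _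
      rw [hv, ih.2]
      exact ⟨rfl, rfl⟩
  refine ⟨⟨next, fun h h' => ⟨fun H => ?_, fun H => ?_⟩, fun _ => 1⟩⟩
  · obtain ⟨i, -, rfl⟩ := H.exists_pow_eq'
    exact (hpow i h).2.symm
  · obtain ⟨i, -, hi⟩ :=
      ((hF (vert G h)).2 ((hmem _ _).2 rfl) ((hmem _ _).2 H.symm)).exists_pow_eq'
    exact ⟨i, by rw [zpow_natCast, (hpow i h).1, hi]⟩

namespace Diagram

/-! ### Cyclic orders at trivalent vertices -/

section Trivalent

theorem next_ne (hT : Trivalent G) (Γ : Diagram G) (h : HalfEdge G) : Γ.next h ≠ h := by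
  intro H
  have hsub : {k : HalfEdge G | vert G k = vert G h} ⊆ {h} := fun k hk =>
    ((Equiv.Perm.SameCycle.eq_of_left ((Γ.sameCycle_iff h k).2 (Eq.symm hk)) H).symm)
  have := Set.encard_le_encard hsub
  rw [hT.encard_halfEdges, Set.encard_singleton] at this
  norm_num at this

/-- Otherwise the orbit of `h` would have at most two elements, but it consists of the three
half-edges at the vertex. -/
theorem next_next_ne [Finite E(G)] (hT : Trivalent G) (Γ : Diagram G) (h : HalfEdge G) :
    Γ.next (Γ.next h) ≠ h := by
  intro H
  have hsub : {k : HalfEdge G | vert G k = vert G h} ⊆ {h, Γ.next h} := fun k hk => by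
    obtain ⟨i, -, rfl⟩ := ((Γ.sameCycle_iff h k).2 (Eq.symm hk)).exists_pow_eq'
    clear hk
    induction i with
    | zero => simp
    | succ i ih =>
      rw [pow_succ', Equiv.Perm.mul_apply]
      rcases ih with ih | ih <;> rw [ih]
      · exact Or.inr rfl
      · exact Or.inl H
  have := (Set.encard_le_encard hsub).trans (Set.encard_insert_le _ _)
  rw [hT.encard_halfEdges, Set.encard_singleton] at this
  norm_num at this

theorem eq_or_eq_of_vert_eq [Finite E(G)] (hT : Trivalent G) (Γ : Diagram G) {h k : HalfEdge G}
    (H : vert G k = vert G h) : k = h ∨ k = Γ.next h ∨ k = Γ.next (Γ.next h) := by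
  have hsub : ({h, Γ.next h, Γ.next (Γ.next h)} : Set (HalfEdge G)) ⊆
      {k | vert G k = vert G h} := by
    rintro _ (rfl | rfl | rfl) <;> simp [vert_next]
  have hcard : ({h, Γ.next h, Γ.next (Γ.next h)} : Set (HalfEdge G)).encard = 3 :=
    Set.encard_eq_three.2 ⟨_, _, _, (Γ.next_ne hT h).symm, (Γ.next_next_ne hT h).symm,
      (Γ.next_ne hT _).symm, rfl⟩
  have := (Set.toFinite _).eq_of_subset_of_encard_le hsub
    ((hT.encard_halfEdges _).trans hcard.symm).le
  have hk : k ∈ ({h, Γ.next h, Γ.next (Γ.next h)} : Set (HalfEdge G)) := by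
    rw [this]
    exact H
  exact hk

theorem next_next_next [Finite E(G)] (hT : Trivalent G) (Γ : Diagram G) (h : HalfEdge G) :
    Γ.next (Γ.next (Γ.next h)) = h := by
  rcases Γ.eq_or_eq_of_vert_eq hT (h := h) (k := Γ.next (Γ.next (Γ.next h)))
    (by simp only [vert_next]) with H | H | H
  · exact H
  · exact absurd (Γ.next.injective H) (Γ.next_next_ne hT h)
  · exact absurd H (Γ.next_ne hT _)

theorem next_symm_eq [Finite E(G)] (hT : Trivalent G) (Γ : Diagram G) (h : HalfEdge G) :
    Γ.next.symm h = Γ.next (Γ.next h) := by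
  rw [Equiv.symm_apply_eq, next_next_next hT]

/-- There are only two cyclic orders of the half-edges at a trivalent vertex. -/
theorem next_eq_or [Finite E(G)] (hT : Trivalent G) (Γ Δ : Diagram G) (x : V(G)) :
    (∀ h, vert G h = x → Γ.next h = Δ.next h) ∨
      ∀ h, vert G h = x → Γ.next h = Δ.next.symm h := by
  obtain ⟨a, ha⟩ := hT.nonempty_halfEdge x
  have hcases : ∀ h, vert G h = x → h = a ∨ h = Δ.next a ∨ h = Δ.next (Δ.next a) := fun h hh =>
    Δ.eq_or_eq_of_vert_eq hT (hh.trans ha.symm)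
  have hstep : ∀ h, Γ.next h = Δ.next h ∨ Γ.next h = Δ.next (Δ.next h) := fun h =>
    (Δ.eq_or_eq_of_vert_eq hT (Γ.vert_next h)).resolve_left (Γ.next_ne hT h)
  have h3 := Δ.next_next_next hT a
  simp only [next_symm_eq hT]
  have n1 := Γ.next_next_ne hT
  have n2 := Γ.next_ne hT
  have n3 := Γ.next_next_next hT a
  -- The successor of a single half-edge determines the whole three-cycle.
  rcases hstep a with H | H
  · left
    have e1 : Γ.next (Δ.next a) = Δ.next (Δ.next a) := by
      refine (hstep _).resolve_right fun H' => ?_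
      rw [h3, ← H] at H'
      exact n1 _ H'
    have e2 : Γ.next (Δ.next (Δ.next a)) = Δ.next (Δ.next (Δ.next a)) := by
      rw [h3, ← e1, ← H, n3]
    intro h hh
    rcases hcases h hh with rfl | rfl | rfl
    · exact H
    · exact e1
    · exact e2
  · right
    have e2 : Γ.next (Δ.next (Δ.next a)) = Δ.next (Δ.next (Δ.next (Δ.next a))) := by
      refine (hstep _).resolve_left fun H' => ?_
      rw [h3, ← H] at H'
      exact n1 _ H'
    have e1 : Γ.next (Δ.next a) = Δ.next (Δ.next (Δ.next a)) := by
      rw [h3] at e2 ⊢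
      rw [← e2, ← H, n3]
    intro h hh
    rcases hcases h hh with rfl | rfl | rfl
    · exact H
    · exact e1
    · exact e2

open scoped Classical in
/-- Ribbon diagrams of a trivalent graph differ, up to equivalence, only by half-twists. -/
theorem exists_equivalent_twist [Fintype E(G)] (hT : Trivalent G) (Γ Δ : Diagram G) :
    ∃ T, Γ.Equivalent (Δ.twist T) := by
  -- Reverse the disks at which the cyclic orders disagree, and twist the edges whose signs then
  -- still disagree.
  let o : V(G) → ℤˣ := fun x => if ∀ h, vert G h = x → Γ.next h = Δ.next h then 1 else -1
  have ho : ∀ e b, o (vert G (e, b)) * Γ.sign e * o (vert G (opp (e, b))) =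
      o (vert G (e, false)) * Γ.sign e * o (vert G (e, true)) := by
    intro e b
    cases b
    · rfl
    · rw [mul_comm, ← mul_assoc, mul_right_comm]
      rfl
  refine ⟨Finset.univ.filter fun e =>
    Δ.sign e ≠ o (vert G (e, false)) * Γ.sign e * o (vert G (e, true)),
    Equiv.refl _, Equiv.refl _, o, fun _ => rfl, fun _ => rfl, fun h hh => ?_, fun h hh => ?_,
    fun h => ?_⟩
  · by_cases H : ∀ k, vert G k = vert G h → Γ.next k = Δ.next k
    · exact H h rfl
    · simp only [o, if_neg H] at hh
      exact absurd hh (by decide)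
  · by_cases H : ∀ k, vert G k = vert G h → Γ.next k = Δ.next k
    · simp only [o, if_pos H] at hh
      exact absurd hh (by decide)
    · exact (next_eq_or hT Γ Δ (vert G h)).resolve_left H h rfl
  · obtain ⟨e, b⟩ := h
    rw [ho]
    simp only [Equiv.refl_apply, twist_sign, Finset.mem_filter, Finset.mem_univ, true_and]
    split_ifs with H
    · exact (Int.units_ne_iff_eq_neg.1 (Ne.symm H)).symm
    · exact not_not.1 H

end Trivalent

/-- An equivalence of ribbon graphs permutes the edges. -/
theorem exists_edgePerm {φ : Equiv.Perm (HalfEdge G)} (hφ : ∀ h, φ (opp h) = opp (φ h)) :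
    ∃ g : Equiv.Perm E(G), ∀ h, (φ h).1 = g h.1 := by
  have key : ∀ ψ : Equiv.Perm (HalfEdge G), (∀ h, ψ (opp h) = opp (ψ h)) →
      ∀ h, (ψ (h.1, false)).1 = (ψ h).1 := by
    intro ψ hψ h
    rcases eq_or_eq_opp (h := h) (h' := (h.1, false)) rfl with H | H
    · rw [← H]
    · rw [H, hψ]
      rfl
  have hφ' : ∀ h, φ.symm (opp h) = opp (φ.symm h) := fun h => by
    rw [Equiv.symm_apply_eq, hφ, Equiv.apply_symm_apply]
  refine ⟨⟨fun e => (φ (e, false)).1, fun e => (φ.symm (e, false)).1, fun e => ?_, fun e => ?_⟩,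
    fun h => (key φ hφ h).symm⟩
  · beta_reduce
    rw [key _ hφ', Equiv.symm_apply_apply]
  · beta_reduce
    rw [key _ hφ, Equiv.apply_symm_apply]

/-! ### Invariance of the Penrose polynomial up to sign -/

section Invariance

open scoped Classical

theorem twist_twist (Γ : Diagram G) (S T : Finset E(G)) :
    (Γ.twist S).twist T = Γ.twist (symmDiff S T) := by
  unfold twist
  congr 1
  funext e
  by_cases hS : e ∈ S <;> by_cases hT : e ∈ T <;> simp [Finset.mem_symmDiff, hS, hT]

variable [Fintype V(G)] [Fintype E(G)]

theorem Equivalent.numFaceColorings_eq {Γ Δ : Diagram G} (H : Γ.Equivalent Δ) (n : ℕ) :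
    Γ.numFaceColorings n = Δ.numFaceColorings n :=
  le_antisymm (FaceColoring.card_le n H.symm) (FaceColoring.card_le n H)

theorem eq_of_forall_natCast_eval_eq {p q : Polynomial ℤ}
    (H : ∀ n : ℕ, p.eval (n : ℤ) = q.eval (n : ℤ)) : p = q :=
  Polynomial.eq_of_infinite_eval_eq _ _
    ((Set.infinite_range_of_injective (Nat.cast_injective (R := ℤ))).mono
      (by rintro _ ⟨n, rfl⟩; exact H n))

/-- The induced permutation of the edges matches states with equivalent state graphs and preserves
their parity. -/
theorem Equivalent.penrose_eq {Γ Δ : Diagram G} (H : Γ.Equivalent Δ) :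
    Γ.penrose = Δ.penrose := by
  refine eq_of_forall_natCast_eval_eq fun n => ?_
  obtain ⟨f, φ, o, h1, h2, h3, h4, h5⟩ := H
  obtain ⟨g, hg⟩ := exists_edgePerm h1
  rw [penrose_eval_eq_sum, penrose_eval_eq_sum]
  refine Fintype.sum_equiv (Equiv.finsetCongr g) _ _ fun S => ?_
  have hS : (Γ.twist S).Equivalent (Δ.twist (Equiv.finsetCongr g S)) := by
    refine ⟨f, φ, o, h1, h2, h3, h4, fun h => ?_⟩
    rw [twist_sign, twist_sign, h5, hg]
    simp only [Equiv.finsetCongr_apply, Finset.mem_map_equiv, Equiv.symm_apply_apply]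
    split_ifs
    · rw [mul_neg, neg_mul]
    · rfl
  rw [hS.numFaceColorings_eq]
  simp

/-- The state `S` of the twisted diagram is the state `symmDiff T S` of the original one. -/
theorem penrose_twist (Γ : Diagram G) (T : Finset E(G)) :
    (Γ.twist T).penrose = (-1) ^ T.card * Γ.penrose := by
  refine eq_of_forall_natCast_eval_eq fun n => ?_
  rw [Polynomial.eval_mul, penrose_eval_eq_sum, penrose_eval_eq_sum, Finset.mul_sum]
  refine Finset.sum_bij' (fun S _ => symmDiff T S) (fun S _ => symmDiff T S) (by simp) (by simp)
    (by simp) (by simp) fun S _ => ?_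
  rw [twist_twist, neg_one_pow_card_symmDiff]
  simp only [Polynomial.eval_pow, Polynomial.eval_neg, Polynomial.eval_one]
  rw [mul_assoc, ← mul_assoc, ← mul_assoc, ← mul_pow]
  simp

theorem penrose_eq_or_neg (hT : Trivalent G) (Γ Δ : Diagram G) :
    Γ.penrose = Δ.penrose ∨ Γ.penrose = -Δ.penrose := by
  obtain ⟨T, hΓ⟩ := exists_equivalent_twist hT Γ Δ
  rw [hΓ.penrose_eq, penrose_twist]
  rcases neg_one_pow_eq_or (Polynomial ℤ) T.card with h | h <;> simp [h]

/-- If the polynomials are opposite and neither has a negative leading coefficient, both are zero.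
-/
theorem Nonneg.penrose_eq (hT : Trivalent G) {Γ Δ : Diagram G} (hΓ : Γ.Nonneg)
    (hΔ : Δ.Nonneg) : Γ.penrose = Δ.penrose := by
  refine (penrose_eq_or_neg hT Γ Δ).elim id fun H => ?_
  unfold Nonneg at hΓ hΔ
  rw [H, Polynomial.leadingCoeff_neg] at hΓ
  have : Δ.penrose = 0 := Polynomial.leadingCoeff_eq_zero.1 (by omega)
  rw [H, this, neg_zero]

/-- One half-twist corrects a wrong sign; a trivalent vertex guarantees an edge to twist. -/
theorem exists_nonneg (hG : Connected G) (hT : Trivalent G) : ∃ Γ : Diagram G, Γ.Nonneg := by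
  obtain ⟨Γ⟩ := Diagram.nonempty (G := G)
  obtain ⟨x, hx⟩ := hG.1
  obtain ⟨h, -⟩ := hT.nonempty_halfEdge ⟨x, hx⟩
  rcases le_total 0 Γ.penrose.leadingCoeff with H | H
  · exact ⟨Γ, H⟩
  · refine ⟨Γ.twist {h.1}, ?_⟩
    unfold Nonneg
    rw [penrose_twist]
    simpa using H

theorem Nonneg.penrose_graph_eq (hT : Trivalent G) {Γ : Diagram G} (hΓ : Γ.Nonneg) :
    Ribbon.penrose G = Γ.penrose := by
  have h : ∃ Γ : Diagram G, Γ.Nonneg := ⟨Γ, hΓ⟩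
  rw [Ribbon.penrose, dif_pos h]
  exact h.choose_spec.penrose_eq hT hΓ

theorem leadingCoeff_nonneg_of_eval_nonneg {p : Polynomial ℤ}
    (H : ∀ n : ℕ, 0 ≤ p.eval (n : ℤ)) : 0 ≤ p.leadingCoeff := by
  by_contra! hneg
  let q := p.map (Int.castRingHom ℝ)
  have hlead : q.leadingCoeff = p.leadingCoeff :=
    Polynomial.leadingCoeff_map_of_injective (Int.castRingHom ℝ).injective_int p
  have hq : ∀ n : ℕ, 0 ≤ q.eval (n : ℝ) := fun n => by
    have := H n
    rw [show (n : ℝ) = Int.castRingHom ℝ (n : ℤ) by simp, Polynomial.eval_map_apply]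
    simpa using this
  -- A constant does not tend to `-∞`, so degree zero is separate.
  rcases Nat.eq_zero_or_pos p.natDegree with h0 | hpos
  · rw [Polynomial.eq_C_of_natDegree_eq_zero h0] at H hneg
    simp only [Polynomial.eval_C, Polynomial.leadingCoeff_C] at H hneg
    exact absurd (H 0) (not_le.2 hneg)
  · have hdeg : 0 < q.degree := by
      rw [Polynomial.degree_map_eq_of_injective (Int.castRingHom ℝ).injective_int]
      exact Polynomial.natDegree_pos_iff_degree_pos.1 hpos
    have ht := (q.tendsto_atBot_of_leadingCoeff_nonpos hdeg
      (by rw [hlead]; exact_mod_cast hneg.le)).comp tendsto_natCast_atTop_atTop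
    obtain ⟨n, hn⟩ := (ht.eventually (Filter.eventually_lt_atBot 0)).exists
    exact absurd (hq n) (not_le.2 hn)

theorem IsPlane.nonneg (hG : Connected G) {Γ : Diagram G} (hΓ : Γ.IsPlane) : Γ.Nonneg :=
  leadingCoeff_nonneg_of_eval_nonneg fun n => by
    rw [hΓ.penrose_eval hG]
    positivity

end Invariance

/-! ### Trivial automorphism group: states and ribbon graphs -/

section TrivialAut

/-- A trivalent graph with a loop has no face coloring: the same face lies on both sides of the
edge next to the loop. -/
theorem numFaceColorings_eq_zero_of_loop [Finite E(G)] (hT : Trivalent G) (Γ : Diagram G)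
    {a : HalfEdge G} (ha : vert G (opp a) = vert G a) (n : ℕ) : Γ.numFaceColorings n = 0 := by
  -- Of three half-edges in cyclic order, one half of the loop directly follows the other; name the
  -- earlier one `a`.
  wlog H : opp a = Γ.next a generalizing a
  · refine this (a := opp a) (by rw [opp_opp, ha]) ?_
    rw [opp_opp]
    rcases Γ.eq_or_eq_of_vert_eq hT ha with h | h | h
    · simp [opp, Prod.ext_iff] at h
    · exact absurd h H
    · rw [h, next_next_next hT]
  have : IsEmpty (Γ.FaceColoring n) := by
    -- The half-edge `Γ.next (opp a)` is the one outside the loop. Following the boundary from one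
    -- of its sides around the loop leads to the other, whether the loop is flat or twisted.
    refine ⟨fun c => c.2 (Γ.next (opp a)) (congrArg c.1 ?_)⟩
    have d1 := Γ.faceAt_disk a
    have d2 := Γ.faceAt_disk (opp a)
    have d3 := Γ.faceAt_disk (Γ.next (opp a))
    rw [H, next_next_next hT] at d3
    rw [← H] at d1
    rw [← H] at d3
    have b1 := Γ.faceAt_band a 1
    have b2 := Γ.faceAt_band a (-1)
    rw [d2, ← d3]
    rcases Int.units_eq_one_or (Γ.sign a.1) with s | s
    · rw [s] at b2
      simpa using b2.symm
    · rw [s] at b1 b2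
      simp only [neg_mul, one_mul, neg_neg] at b1 b2
      rw [b1, ← d1, b2]
  exact Nat.card_of_isEmpty

/-- Trivial action on vertices and edges leaves only the exchange of the two halves of an edge,
which would move a vertex unless the edge is a loop. -/
theorem eq_self_of_trivialAut (hA : TrivialAut G)
    (hL : ∀ h : HalfEdge G, vert G (opp h) ≠ vert G h)
    {f : Equiv.Perm V(G)} {φ : Equiv.Perm (HalfEdge G)} (h1 : ∀ h, φ (opp h) = opp (φ h))
    (h2 : ∀ h, vert G (φ h) = f (vert G h)) (h : HalfEdge G) : φ h = h := by
  obtain ⟨g, hg⟩ := exists_edgePerm h1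
  obtain ⟨rfl, rfl⟩ := hA f g fun e x y => by
    have ho : ∀ e b, ((e, !b) : HalfEdge G) = opp (e, b) := fun _ _ => rfl
    have hmap : ∀ b, ∃ b', φ (e, b) = (g e, b') := fun b => ⟨(φ (e, b)).2, Prod.ext (hg _) rfl⟩
    have hmap' : ∀ b', ∃ b, φ (e, b) = (g e, b') := fun b' => by
      obtain ⟨b, hb⟩ := hmap b'
      by_cases hbb : b = b'
      · exact ⟨b', hbb ▸ hb⟩
      · refine ⟨!b', ?_⟩
        rw [ho, h1, hb]
        simp only [opp, Prod.mk.injEq, true_and]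
        cases b <;> cases b' <;> first | rfl | exact absurd rfl hbb
    rw [isLink_iff, isLink_iff]
    constructor
    · rintro ⟨b, rfl, rfl⟩
      obtain ⟨b', hb⟩ := hmap b
      refine ⟨b', ?_, ?_⟩
      · rw [← hb, h2]
      · rw [ho, ← hb, ← h1, h2]
        rfl
    · rintro ⟨b', hx, hy⟩
      obtain ⟨b, hb⟩ := hmap' b'
      rw [ho, ← hb, ← h1, h2] at hy
      rw [← hb, h2] at hx
      exact ⟨b, f.injective hx, f.injective hy⟩
  rcases eq_or_eq_opp (hg h) with H | H
  · exact H
  · have := h2 h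
    rw [H] at this
    exact absurd this (hL h)

-- An equivalence fixes every half-edge. It cannot reverse a disk, since a three-cycle is not its
-- own inverse, so it preserves all signs.
open scoped Classical in
theorem mk_twist_injective [Finite E(G)] (hT : Trivalent G) (hA : TrivialAut G)
    (hL : ∀ h : HalfEdge G, vert G (opp h) ≠ vert G h) (Γ : Diagram G) :
    Function.Injective fun S => RibbonGraph.mk (Γ.twist S) := by
  intro S T H
  obtain ⟨f, φ, o, h1, h2, -, h4, h5⟩ := Quotient.exact H
  have hφ := eq_self_of_trivialAut hA hL h1 h2
  have ho : ∀ h, o (vert G h) = 1 := fun h => by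
    refine (Int.units_eq_one_or _).resolve_right fun hh => ?_
    have := h4 h hh
    rw [hφ, hφ, Equiv.eq_symm_apply] at this
    exact Γ.next_next_ne hT h this
  ext e
  have := h5 (e, false)
  rw [hφ, ho, ho, one_mul, mul_one, twist_sign, twist_sign] at this
  have hne : -Γ.sign e ≠ Γ.sign e := Int.units_ne_iff_eq_neg.2 rfl
  split_ifs at this with hT hS hS
  · exact iff_of_true hS hT
  · exact absurd this hne
  · exact absurd this hne.symm
  · exact iff_of_false hS hT

theorem mk_twist_surjective [Fintype E(G)] (hT : Trivalent G) (Γ : Diagram G) :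
    Function.Surjective fun S => RibbonGraph.mk (Γ.twist S) := by
  intro R
  induction R using Quotient.ind with
  | _ Δ =>
    obtain ⟨T, H⟩ := exists_equivalent_twist hT Δ Γ
    exact ⟨T, Quotient.sound H.symm⟩

theorem ribbonGraph_numFaceColorings_eq_zero_of_loop [Finite V(G)] [Finite E(G)]
    (hT : Trivalent G) {a : HalfEdge G} (ha : vert G (opp a) = vert G a) (n : ℕ)
    (R : RibbonGraph G) : R.numFaceColorings n = 0 := by
  induction R using Quotient.ind with
  | _ Δ => exact Δ.numFaceColorings_eq_zero_of_loop hT ha n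

open scoped Classical

variable [Fintype V(G)] [Fintype E(G)]

/-- Without loops this is reindexing along a bijection; with a loop both sides vanish. -/
theorem sum_ribbonGraph (hT : Trivalent G) (hA : TrivialAut G) (Γ : Diagram G) (n : ℕ) :
    ∑ S : Finset E(G), ((Γ.twist S).numFaceColorings n : ℤ) =
      ∑ R : RibbonGraph G, (R.numFaceColorings n : ℤ) := by
  by_cases hL : ∀ h : HalfEdge G, vert G (opp h) ≠ vert G h
  · exact Function.Bijective.sum_comp ⟨mk_twist_injective hT hA hL Γ, mk_twist_surjective hT Γ⟩
      fun R => (R.numFaceColorings n : ℤ)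
  · push Not at hL
    obtain ⟨a, ha⟩ := hL
    simp [numFaceColorings_eq_zero_of_loop hT _ ha,
      ribbonGraph_numFaceColorings_eq_zero_of_loop hT ha]

theorem penrose_eval_eq_sum_ribbonGraph (hT : Trivalent G) (hA : TrivialAut G) (Γ : Diagram G)
    (n : ℕ) :
    Γ.penrose.eval (n : ℤ) =
      (∑ R : RibbonGraph G with RibbonGraph.IsEven Γ R, (R.numFaceColorings n : ℤ))
        - ∑ R : RibbonGraph G with ¬ RibbonGraph.IsEven Γ R, (R.numFaceColorings n : ℤ) := by
  rw [Diagram.penrose_eval]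
  by_cases hL : ∀ h : HalfEdge G, vert G (opp h) ≠ vert G h
  · have hinj := mk_twist_injective hT hA hL Γ
    let E := Equiv.ofBijective _ ⟨hinj, mk_twist_surjective hT Γ⟩
    -- By injectivity a ribbon graph determines its set of twisted edges, so no ribbon graph is
    -- reached by twist sets of both parities.
    have heven : ∀ S : Finset E(G), Even S.card ↔ RibbonGraph.IsEven Γ (E S) := fun S =>
      ⟨fun hS => ⟨S, hS, rfl⟩, fun ⟨T, hT, h⟩ => hinj h ▸ hT⟩
    congr 1 <;> exact Finset.sum_equiv E (by simp [heven]) fun S _ => rfl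
  · push Not at hL
    obtain ⟨a, ha⟩ := hL
    simp [numFaceColorings_eq_zero_of_loop hT _ ha,
      ribbonGraph_numFaceColorings_eq_zero_of_loop hT ha]

end TrivialAut

end Diagram

end Ribbon

end

open scoped Classical in
theorem theoremE {α β : Type*} (G : Graph α β) [Fintype V(G)] [Fintype E(G)]
    (hG : Ribbon.Connected G) :
    -- the version for signed ribbon diagrams
    (∀ (Γ : Ribbon.Diagram G) (n : ℕ),
      Γ.penrose.eval (n : ℤ) =
        (∑ S : Finset E(G) with Even S.card, ((Γ.twist S).numFaceColorings n : ℤ))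
          - ∑ S : Finset E(G) with ¬ Even S.card, ((Γ.twist S).numFaceColorings n : ℤ)) ∧
    (∀ Γ : Ribbon.Diagram G, Γ.IsPlane → ∀ n : ℕ,
      Γ.penrose.eval (n : ℤ) = ∑ S : Finset E(G), ((Γ.twist S).numFaceColorings n : ℤ)) ∧
    -- the Penrose polynomial of a trivalent graph is well defined
    (Ribbon.Trivalent G →
      (∃ Γ : Ribbon.Diagram G, Γ.Nonneg) ∧
      ∀ Γ : Ribbon.Diagram G, Γ.Nonneg → Ribbon.penrose G = Γ.penrose) ∧
    -- the version for trivalent graphs with trivial automorphism group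
    (Ribbon.Trivalent G → Ribbon.TrivialAut G →
      (∀ Γ : Ribbon.Diagram G, Γ.Nonneg → ∀ n : ℕ,
        (Ribbon.penrose G).eval (n : ℤ) =
          (∑ R : Ribbon.RibbonGraph G with Ribbon.RibbonGraph.IsEven Γ R,
            (R.numFaceColorings n : ℤ))
          - ∑ R : Ribbon.RibbonGraph G with ¬ Ribbon.RibbonGraph.IsEven Γ R,
            (R.numFaceColorings n : ℤ)) ∧
      (Ribbon.Planar G → ∀ n : ℕ,
        (Ribbon.penrose G).eval (n : ℤ) =
          ∑ R : Ribbon.RibbonGraph G, (R.numFaceColorings n : ℤ))) := by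
  refine ⟨fun Γ n => Γ.penrose_eval n, fun Γ hΓ n => hΓ.penrose_eval hG n,
    fun hT => ⟨Ribbon.Diagram.exists_nonneg hG hT, fun Γ hΓ => hΓ.penrose_graph_eq hT⟩,
    fun hT hA => ⟨fun Γ hΓ n => ?_, fun ⟨Γ, hΓ⟩ n => ?_⟩⟩
  · rw [hΓ.penrose_graph_eq hT, Γ.penrose_eval_eq_sum_ribbonGraph hT hA]
  -- The values of a plane diagram are counts, so it is nonnegative and computes the polynomial of
  -- the graph.
  · rw [(hΓ.nonneg hG).penrose_graph_eq hT, hΓ.penrose_eval hG,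
      Ribbon.Diagram.sum_ribbonGraph hT hA]
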